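/- Let $R$ be a commutative ring with $1$ such that $R=2R$, let $n\ge 2$, and let $\phi$ be a skew-symmetric $2n\times 2n$ matrix over $R$ of Pfaffian $1$ (so $\phi$ is invertible). Write $$\phi=\begin{pmatrix}0&-c^t\\ c&\nu\end{pmatrix},\qquad \phi^{-1}=\begin{pmatrix}0&d^t\\ -d&\mu\end{pmatrix},\qquad c,d\in R^{2n-1}.$$ Let $\mathrm{Sp}_\phi(R)=\{\alpha\in \mathrm{GL}_{2n}(R)\mid \alpha^t\phi\alpha=\phi\}$. For $v\in R^{2n-1}$ put $$C_\phi(v)=\begin{pmatrix}1&0\\ v& I_{2n-1}+dv^t\nu\end{pmatrix},\qquad R_\phi(v)=\begin{pmatrix}1&v^t\\ 0& I_{2n-1}+\mu vc^t\end{pmatrix};$$ these matrices lie in $\mathrm{Sp}_\phi(R)$. Let $\mathrm{ESp}_\phi(R)\le \mathrm{Sp}_\phi(R)$ be the subgroup generated by all $C_\phi(v)$ and $R_\phi(v)$, $v\in R^{2n-1}$. For an ideal $I$ of $R$, let $\mathrm{ESp}_\phi(I)$ be the subgroup generated by the $C_\phi(v)$ and $R_\phi(v)$ with $v\in I^{2n-1}$,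 and let $\mathrm{ESp}_\phi(R,I)$ be the normal closure of $\mathrm{ESp}_\phi(I)$ in $\mathrm{ESp}_\phi(R)$. For a ring homomorphism $R\to S$, the groups $\mathrm{Sp}_{\phi\otimes S}(S)$ and $\mathrm{ESp}_{\phi\otimes S}(S)$ are those defined in the same way over $S$ from the image of $\phi$. 1. If $R$ is local, then $\mathrm{ESp}_\phi(R)$ is a normal subgroup of $\mathrm{Sp}_\phi(R)$. 2. If $R$ is local, then for every ideal $I$ of $R$, $\mathrm{ESp}_\phi(R,I)$ is a normal subgroup of $\mathrm{Sp}_\phi(R)$. 3. For every maximal ideal $\mathfrak m$ of $R$ ($R$ not necessarily local), $\mathrm{ESp}_{\phi\otimes R_{\mathfrak m}[X]}(R_{\mathfrak m}[X])$ is a normal subgroup of $\mathrm{Sp}_{\phi\otimes R_{\mathfrak m}[X]}(R_{\mathfrak m}[X])$. -/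

import Mathlib

namespace ElemSympl

open Matrix

variable {R : Type*} [CommRing R]

/-- The Pfaffian of a square matrix, by expansion along the first row:
`Pf A = ∑_{j ≥ 1} (-1)^(j-1) a_{0,j} Pf (A with rows and columns 0 and j deleted)` (indices from
`0`), with `Pf = 1` in size `0` and `Pf = 0` in size `1`, hence in every odd size.  It is the usual
Pfaffian on alternating matrices; only the entries above the diagonal enter. -/
def pfaffian : (N : ℕ) → Matrix (Fin N) (Fin N) R → R
  | 0, _ => 1
  | 1, _ => 0
  | N + 2, A => ∑ j : Fin (N + 1), (-1) ^ (j : ℕ) * A 0 j.succ *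
      pfaffian N (A.submatrix (fun k => (j.succAbove k).succ) (fun k => (j.succAbove k).succ))

/-- The symplectic group `Sp_φ(R) = {g ∈ GL_N(R) | gᵗ φ g = φ}`. -/
def Sp {N : ℕ} (φ : Matrix (Fin N) (Fin N) R) : Subgroup (GL (Fin N) R) where
  carrier := {g | (g : Matrix (Fin N) (Fin N) R)ᵀ * φ * (g : Matrix (Fin N) (Fin N) R) = φ}
  one_mem' := by simp
  mul_mem' := by
    intro a b ha hb
    simp only [Set.mem_ofPred_eq] at ha hb ⊢
    rw [GeneralLinearGroup.coe_mul, transpose_mul]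
    calc (b : Matrix (Fin N) (Fin N) R)ᵀ * (a : Matrix (Fin N) (Fin N) R)ᵀ * φ * (a * b)
        = (b : Matrix (Fin N) (Fin N) R)ᵀ * ((a : Matrix (Fin N) (Fin N) R)ᵀ * φ * a) * b := by
          simp only [Matrix.mul_assoc]
      _ = φ := by rw [ha, hb]
  inv_mem' := by
    intro a ha
    simp only [Set.mem_ofPred_eq] at ha ⊢
    have h : (a : Matrix (Fin N) (Fin N) R) * ((a⁻¹ : GL (Fin N) R) : Matrix _ _ R) = 1 := by
      rw [← GeneralLinearGroup.coe_mul, mul_inv_cancel, GeneralLinearGroup.coe_one]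
    have h' := congrArg transpose h
    rw [transpose_mul, transpose_one] at h'
    calc ((a⁻¹ : GL (Fin N) R) : Matrix _ _ R)ᵀ * φ * ((a⁻¹ : GL (Fin N) R) : Matrix _ _ R)
        = ((a⁻¹ : GL (Fin N) R) : Matrix _ _ R)ᵀ *
            ((a : Matrix (Fin N) (Fin N) R)ᵀ * φ * (a : Matrix (Fin N) (Fin N) R)) *
            ((a⁻¹ : GL (Fin N) R) : Matrix _ _ R) := by rw [ha]
      _ = (((a⁻¹ : GL (Fin N) R) : Matrix _ _ R)ᵀ * (a : Matrix (Fin N) (Fin N) R)ᵀ) * φ *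
            ((a : Matrix (Fin N) (Fin N) R) * ((a⁻¹ : GL (Fin N) R) : Matrix _ _ R)) := by simp only [Matrix.mul_assoc]
      _ = φ := by rw [h, h', Matrix.one_mul, Matrix.mul_one]

section Generators

variable {l : ℕ} (φ : Matrix (Fin (l + 1)) (Fin (l + 1)) R)

/-- The column `c` in `φ = [[0, -cᵗ], [c, ν]]`. -/
def colC : Fin l → R := fun i => φ i.succ 0

/-- The block `ν` in `φ = [[0, -cᵗ], [c, ν]]`. -/
def blockNu : Matrix (Fin l) (Fin l) R := φ.submatrix Fin.succ Fin.succ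

/-- The column `d` in `φ⁻¹ = [[0, dᵗ], [-d, μ]]`. -/
noncomputable def colD : Fin l → R := fun i => φ⁻¹ 0 i.succ

/-- The block `μ` in `φ⁻¹ = [[0, dᵗ], [-d, μ]]`. -/
noncomputable def blockMu : Matrix (Fin l) (Fin l) R := φ⁻¹.submatrix Fin.succ Fin.succ

/-- `α_φ(v) = I + d vᵗ ν`. -/
noncomputable def alpha (v : Fin l → R) : Matrix (Fin l) (Fin l) R :=
  1 + vecMulVec (colD φ) v * blockNu φ

/-- `β_φ(v) = I + μ v cᵗ`. -/
noncomputable def beta (v : Fin l → R) : Matrix (Fin l) (Fin l) R :=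
  1 + blockMu φ * vecMulVec v (colC φ)

/-- `C_φ(v) = [[1, 0], [v, α_φ(v)]]`. -/
noncomputable def elemC (v : Fin l → R) : Matrix (Fin (l + 1)) (Fin (l + 1)) R :=
  Matrix.of (vecCons (vecCons 1 0) fun i => vecCons (v i) (alpha φ v i))

/-- `R_φ(v) = [[1, vᵗ], [0, β_φ(v)]]`. -/
noncomputable def elemR (v : Fin l → R) : Matrix (Fin (l + 1)) (Fin (l + 1)) R :=
  Matrix.of (vecCons (vecCons 1 v) fun i => vecCons 0 (beta φ v i))

end Generators

section Membership

variable {l : ℕ} {φ : Matrix (Fin (l + 1)) (Fin (l + 1)) R}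

theorem inv_skew (hs : φᵀ = -φ) (hu : IsUnit φ.det) : (φ⁻¹)ᵀ = -φ⁻¹ := by
  rw [transpose_nonsing_inv, hs]
  apply inv_eq_left_inv
  simp [nonsing_inv_mul _ hu]

theorem elemC_isometry (h2 : IsUnit (2:R)) (hs : φᵀ = -φ) (hu : IsUnit φ.det) (v : Fin l → R) :
    (elemC φ v)ᵀ * φ * elemC φ v = φ := by
  have key : ∀ x : R, x = - x → x = 0 := fun x hx => by
    apply h2.mul_left_cancel; linear_combination hx
  have hsk : ∀ i j, φ j i = - φ i j := fun i j => congrFun (congrFun hs i) j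
  have hisk : ∀ i j, φ⁻¹ j i = - φ⁻¹ i j := fun i j => congrFun (congrFun (inv_skew hs hu) i) j
  have e1 := mul_nonsing_inv φ hu
  set c := colC φ with hc
  set d := colD φ with hd
  set ν := blockNu φ with hν
  have φ00 : φ 0 0 = 0 := key _ (hsk 0 0)
  have i00 : φ⁻¹ 0 0 = 0 := key _ (hisk 0 0)
  have νt : νᵀ = -ν := by ext i j; simp [hν, blockNu, hsk j.succ i.succ]
  have hνd : ν *ᵥ d = 0 := by
    ext i
    have := congrFun (congrFun e1 i.succ) 0
    rw [mul_apply, Fin.sum_univ_succ, i00] at this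
    simp only [mulVec, dotProduct, hν, hd, blockNu, colD, submatrix_apply, Pi.zero_apply]
    simp [hisk 0] at this
    simpa using this
  have hcd : c ⬝ᵥ d = 1 := by
    have := congrFun (congrFun e1 0) 0
    rw [mul_apply, Fin.sum_univ_succ, i00] at this
    simp [hisk 0] at this
    simp only [dotProduct, hc, hd, colC, colD, hsk 0]
    simpa using this
  have hνα : ν * alpha φ v = ν := by
    rw [alpha, ← hd, ← hν, mul_add, mul_one, ← Matrix.mul_assoc, mul_vecMulVec, hνd]; simp
  have hmul : φ * elemC φ v = Matrix.of (vecCons (vecCons (-(c ⬝ᵥ v)) (-(c ᵥ* alpha φ v)))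
      fun i => vecCons (c i + (ν *ᵥ v) i) (ν i)) := by
    ext i j
    rw [mul_apply, Fin.sum_univ_succ]
    refine Fin.cases ?_ (fun i => ?_) i <;> refine Fin.cases ?_ (fun j => ?_) j
    · simp [elemC, φ00, dotProduct, hc, colC, hsk 0]
    · simp [elemC, φ00, vecMul, dotProduct, hc, colC, hsk 0]
    · simp [elemC, mulVec, dotProduct, hc, hν, colC, blockNu]
    · conv_rhs => simp only [of_apply, cons_val_succ]; rw [← hνα, mul_apply]
      simp [elemC, hν, blockNu]
  rw [Matrix.mul_assoc, hmul]
  have ct : (alpha φ v)ᵀ = 1 - vecMulVec (ν *ᵥ v) d := by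
    rw [alpha, transpose_add, transpose_mul, ← hν, νt, ← hd, transpose_one, transpose_vecMulVec,
      mul_vecMulVec, neg_mulVec, neg_vecMulVec, sub_eq_add_neg]
  have dν : d ᵥ* ν = 0 := by
    have : νᵀ *ᵥ d = 0 := by rw [νt, neg_mulVec, hνd, neg_zero]
    rwa [mulVec_transpose] at this
  have h3 : (alpha φ v)ᵀ *ᵥ (c + ν *ᵥ v) = c := by
    rw [ct, sub_mulVec, one_mulVec, vecMulVec_mulVec, dotProduct_add, dotProduct_comm d c, hcd,
      dotProduct_mulVec, dν]; simp
  have h4 : (alpha φ v)ᵀ * ν = ν := by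
    rw [ct, sub_mul, one_mul, vecMulVec_mul, dν]; simp
  have h5 : v ⬝ᵥ (ν *ᵥ v) = 0 := by
    apply key
    conv_lhs => rw [dotProduct_mulVec, ← mulVec_transpose, νt, neg_mulVec, neg_dotProduct, dotProduct_comm]
  have h6 : c ᵥ* alpha φ v = c + v ᵥ* ν := by
    rw [alpha, ← hd, ← hν, vecMul_add, vecMul_one, ← vecMul_vecMul, vecMul_vecMulVec, hcd, one_smul]
  ext i j
  rw [mul_apply, Fin.sum_univ_succ]
  refine Fin.cases ?_ (fun i => ?_) i <;> refine Fin.cases ?_ (fun j => ?_) j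
  · have : ∑ i, v i * (c i + (ν *ᵥ v) i) = v ⬝ᵥ c + v ⬝ᵥ (ν *ᵥ v) := by
      rw [← dotProduct_add]; rfl
    simp [elemC, φ00, this, h5, dotProduct_comm v c]
  · have : ∑ i, v i * ν i j = (v ᵥ* ν) j := rfl
    have h6j := congrFun h6 j
    have hcj : c j = φ j.succ 0 := rfl
    simp only [Pi.add_apply] at h6j
    simp [elemC, this, hsk j.succ 0, h6j, hcj]
  · have : ∑ k, alpha φ v k i * (c k + (ν *ᵥ v) k) = c i := congrFun h3 i
    simp [elemC, this]
    rfl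
  · have : ∑ k, alpha φ v k i * ν k j = ν i j := congrFun (congrFun h4 i) j
    simp [elemC, this]
    rfl

theorem elemR_isometry (h2 : IsUnit (2:R)) (hs : φᵀ = -φ) (hu : IsUnit φ.det) (v : Fin l → R) :
    (elemR φ v)ᵀ * φ * elemR φ v = φ := by
  have key : ∀ x : R, x = - x → x = 0 := fun x hx => by
    apply h2.mul_left_cancel; linear_combination hx
  have hsk : ∀ i j, φ j i = - φ i j := fun i j => congrFun (congrFun hs i) j
  have hisk : ∀ i j, φ⁻¹ j i = - φ⁻¹ i j := fun i j => congrFun (congrFun (inv_skew hs hu) i) j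
  have e1 := mul_nonsing_inv φ hu
  set c := colC φ with hc
  set d := colD φ with hd
  set ν := blockNu φ with hν
  set μ := blockMu φ with hμ
  have φ00 : φ 0 0 = 0 := key _ (hsk 0 0)
  have νt : νᵀ = -ν := by ext i j; simp [hν, blockNu, hsk j.succ i.succ]
  have μt : μᵀ = -μ := by ext i j; simp [hμ, blockMu, hisk j.succ i.succ]
  have cμ : c ᵥ* μ = 0 := by
    ext i
    have := congrFun (congrFun e1 0) i.succ
    rw [mul_apply, Fin.sum_univ_succ, φ00] at this
    simp only [vecMul, dotProduct, hμ, hc, blockMu, colC, submatrix_apply, Pi.zero_apply]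
    simp [hsk 0, Fin.succ_ne_zero, eq_comm (a := (0 : Fin (l+1)))] at this ⊢
    simpa [Matrix.one_apply, Fin.succ_ne_zero, (Fin.succ_ne_zero _).symm] using this
  have νμ : ν * μ = 1 - vecMulVec c d := by
    ext i j
    have := congrFun (congrFun e1 i.succ) j.succ
    rw [mul_apply, Fin.sum_univ_succ] at this
    simp only [mul_apply, Matrix.sub_apply, vecMulVec_apply, hν, hμ, hc, hd, blockNu, blockMu, colC, colD,
      submatrix_apply]
    simp only [Matrix.one_apply, Fin.succ_inj] at this ⊢
    linear_combination this
  have cβ : c ᵥ* beta φ v = c := by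
    rw [beta, ← hμ, ← hc, vecMul_add, vecMul_one, ← vecMul_vecMul, cμ]; simp
  have νβ : ν * beta φ v = ν + vecMulVec v c - (d ⬝ᵥ v) • vecMulVec c c := by
    rw [beta, ← hμ, ← hc, mul_add, mul_one, ← Matrix.mul_assoc, νμ, sub_mul, one_mul,
      vecMulVec_mul_vecMulVec, add_sub_assoc]
    simp [vecMulVec_smul]
  have βν : (beta φ v)ᵀ * ν = ν - vecMulVec c v + (d ⬝ᵥ v) • vecMulVec c c := by
    have : (beta φ v)ᵀ * ν = - (ν * beta φ v)ᵀ := by rw [transpose_mul, νt]; simp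
    rw [this, νβ]
    simp only [transpose_sub, transpose_add, νt, transpose_smul, transpose_vecMulVec]
    abel
  have vμv : v ⬝ᵥ (μ *ᵥ v) = 0 := by
    apply key
    conv_lhs => rw [dotProduct_mulVec, ← mulVec_transpose, μt, neg_mulVec, neg_dotProduct, dotProduct_comm]
  have βv : v ᵥ* (beta φ v) = v := by
    rw [beta, ← hμ, ← hc, vecMul_add, vecMul_one, ← vecMul_vecMul, vecMul_vecMulVec,
      ← dotProduct_mulVec, vμv]; simp
  have hmul : φ * elemR φ v = Matrix.of (vecCons (vecCons 0 (-c))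
      fun i => vecCons (c i) (fun j => c i * v j + (ν * beta φ v) i j)) := by
    ext i j
    rw [mul_apply, Fin.sum_univ_succ]
    refine Fin.cases ?_ (fun i => ?_) i <;> refine Fin.cases ?_ (fun j => ?_) j
    · simp [elemR, φ00]
    · have := congrFun cβ j
      simp only [vecMul, dotProduct, hc, colC] at this
      simp [elemR, φ00, hc, colC]
      simp only [hsk (Fin.succ _) 0]
      simp [this]
    · simp [elemR, hc, colC]
    · simp [elemR, hc, colC, mul_apply, hν, blockNu]
  rw [Matrix.mul_assoc, hmul, νβ]
  ext i j
  rw [mul_apply, Fin.sum_univ_succ]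
  refine Fin.cases ?_ (fun i => ?_) i <;> refine Fin.cases ?_ (fun j => ?_) j
  · simp [elemR, φ00]
  · simp [elemR, hsk j.succ 0, hc, colC]
  · have : ∑ k, c k * beta φ v k i = c i := congrFun cβ i
    simp [elemR]
    simp only [mul_comm _ (c _), this]
    rfl
  · have a1 : ∑ k, c k * beta φ v k i = c i := congrFun cβ i
    have a2 : ∑ k, v k * beta φ v k i = v i := congrFun βv i
    have a3 : ∑ k, beta φ v k i * ν k j = ν i j - c i * v j + (d ⬝ᵥ v) * (c i * c j) := by
      have := congrFun (congrFun βν i) j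
      simpa [mul_apply, vecMulVec_apply] using this
    have a4 : ∑ k, beta φ v k i * (c k * v j + (ν k j + v k * c j - (d ⬝ᵥ v) * (c k * c j)))
        = (∑ k, c k * beta φ v k i) * (v j - (d ⬝ᵥ v) * c j) + (∑ k, beta φ v k i * ν k j)
          + (∑ k, v k * beta φ v k i) * c j := by
      simp only [Finset.sum_mul, ← Finset.sum_add_distrib]
      exact Finset.sum_congr rfl fun k _ => by ring
    rw [a1, a2, a3] at a4
    simp [elemR, vecMulVec_apply, a4]
    change _ = ν i j
    ring

/-- A matrix preserving an invertible `φ` is the matrix of an element of `Sp φ`. -/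
theorem exists_Sp_of_isometry (hu : IsUnit φ.det) (A : Matrix (Fin (l + 1)) (Fin (l + 1)) R)
    (hA : Aᵀ * φ * A = φ) : ∃ g : Sp φ, ((g : GL (Fin (l + 1)) R) : Matrix _ _ R) = A := by
  have h : IsUnit A.det := by
    rw [← hA, det_mul] at hu
    exact isUnit_of_mul_isUnit_right hu
  exact ⟨⟨GeneralLinearGroup.mk'' A h, hA⟩, rfl⟩

/-- When `2` is a unit and `φ` is invertible and skew-symmetric, every `C_φ(v)` lies in `Sp φ`. -/
theorem exists_Sp_elemC (h2 : IsUnit (2 : R)) (hs : φᵀ = -φ) (hu : IsUnit φ.det) (v : Fin l → R) :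
    ∃ g : Sp φ, ((g : GL (Fin (l + 1)) R) : Matrix _ _ R) = elemC φ v :=
  exists_Sp_of_isometry hu _ (elemC_isometry h2 hs hu v)

/-- When `2` is a unit and `φ` is invertible and skew-symmetric, every `R_φ(v)` lies in `Sp φ`. -/
theorem exists_Sp_elemR (h2 : IsUnit (2 : R)) (hs : φᵀ = -φ) (hu : IsUnit φ.det) (v : Fin l → R) :
    ∃ g : Sp φ, ((g : GL (Fin (l + 1)) R) : Matrix _ _ R) = elemR φ v :=
  exists_Sp_of_isometry hu _ (elemR_isometry h2 hs hu v)

end Membership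

section Elementary

variable {l : ℕ} (φ : Matrix (Fin (l + 1)) (Fin (l + 1)) R)

/-- The elementary symplectic group `ESp_φ(R)`, as a subgroup of `Sp_φ(R)`: it is generated by all
`C_φ(v)` and `R_φ(v)`, which do lie in `Sp_φ(R)` when `2` is a unit and `φ` is invertible and
skew-symmetric (`exists_Sp_elemC`, `exists_Sp_elemR`). -/
def ESp : Subgroup (Sp φ) :=
  Subgroup.closure {g : Sp φ | ∃ v : Fin l → R,
    ((g : GL (Fin (l + 1)) R) : Matrix _ _ R) = elemC φ v ∨
    ((g : GL (Fin (l + 1)) R) : Matrix _ _ R) = elemR φ v}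

/-- The group `ESp_φ(I)`, as a subgroup of `Sp_φ(R)`: it is generated by the `C_φ(v)` and `R_φ(v)`
for which all the entries of `v` lie in `I`. -/
def ESpIdeal (I : Ideal R) : Subgroup (Sp φ) :=
  Subgroup.closure {g : Sp φ | ∃ v : Fin l → R, (∀ i, v i ∈ I) ∧
    (((g : GL (Fin (l + 1)) R) : Matrix _ _ R) = elemC φ v ∨
     ((g : GL (Fin (l + 1)) R) : Matrix _ _ R) = elemR φ v)}

/-- The relative elementary symplectic group `ESp_φ(R, I)`, the normal closure of `ESp_φ(I)` in
`ESp_φ(R)`, viewed as a subgroup of `Sp_φ(R)`. -/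
def relESp (I : Ideal R) : Subgroup (Sp φ) :=
  (Subgroup.normalClosure {g : ESp φ | (g : Sp φ) ∈ ESpIdeal φ I}).map (ESp φ).subtype

end Elementary

end ElemSympl

namespace ElemSympl

open Matrix

/-! ### The Pfaffian as an alternating form -/

section Pfaffian

variable {R M : Type*} [CommRing R] [AddCommGroup M] [Module R M]

/-! The relative group `relESp φ I` is identified with a group that is visibly normal in `Sp φ`: the
one generated by the conjugates of the symplectic transvections T_x(a) : z ↦ z + a⟨x,z⟩x, with x any
vector and a in I (`relESp_eq_transvectionGroup`). Since g T_x(a) g⁻¹ = T_{gx}(a) for an isometry g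
(`mul_longT`), this group is contained in every subgroup that contains all the T_x(a). The absolute
group is the case I = R, and the polynomial ring over the localization is handled by the same
argument over that ring.

The vectors e = (1,0) and u = (0,d) form a hyperbolic pair, and C_φ(v), R_φ(v) are Eichler
transformations along u and e, each times a transvection along the same vector (`elemC_eq`,
`elemR_eq`). As 2 is invertible, an Eichler transformation along x and a vector y orthogonal to x is
a product of two transvections along x + y and x - y, so the generators with v in I lie in the
transvection group.

Conversely, the generators give the Eichler transformations along e or u with vectors p orthogonal
to both. Commutators of these give T_p(a). They combine to Eichler transformations between p and any
x in the plane of e and u; commutators of those give T_x(2b⟨p,q⟩) for p, q orthogonal to the plane.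
In rank above 2 the values ⟨p,q⟩ generate the unit ideal (`span_symForm_orthogonal_eq_top`), so all
T_x(a) are reached. A general vector is an orthogonal sum p + x.

Separately, Pfaffian 1 must be shown to force det φ to be a unit. The Pfaffian of a Gram matrix is
alternating multilinear in the vectors, and its expansion along the first row then yields a left
inverse of φ. -/

theorem contractLeft_ιMulti (d : Module.Dual R M) :
    ∀ (N : ℕ) (v : Fin (N + 1) → M),
      CliffordAlgebra.contractLeft (Q := (0 : QuadraticForm R M)) d
        (ExteriorAlgebra.ιMulti R (N + 1) v) =
      ∑ j : Fin (N + 1), ((-1) ^ (j : ℕ) * d (v j)) • ExteriorAlgebra.ιMulti R N (v ∘ j.succAbove)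
  | 0, v => by
    rw [ExteriorAlgebra.ιMulti_succ_apply]
    erw [CliffordAlgebra.contractLeft_ι_mul]
    simp only [ExteriorAlgebra.ιMulti_zero_apply]
    erw [CliffordAlgebra.contractLeft_one]
    simp
  | N + 1, v => by
    rw [ExteriorAlgebra.ιMulti_succ_apply]
    erw [CliffordAlgebra.contractLeft_ι_mul]
    rw [contractLeft_ιMulti d N, Fin.sum_univ_succ (n := N + 1), Finset.mul_sum, sub_eq_add_neg,
      ← Finset.sum_neg_distrib]
    congr 1
    · simp only [Fin.val_zero, pow_zero, one_mul]
      rfl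
    · refine Finset.sum_congr rfl fun j _ => ?_
      rw [ExteriorAlgebra.ιMulti_succ_apply, mul_smul_comm, ← neg_smul]
      congr 1
      · simp [Matrix.vecTail, pow_succ]
      · simp only [Function.comp_apply, Fin.succ_succAbove_zero]
        congr 2
        ext k
        simp [Matrix.vecTail]

/-- Because B is alternating, changing the form by -B maps the exterior algebra to itself; the
constant term of this map is the Pfaffian. -/
theorem toQuadraticMap_neg_eq_zero_sub_zero {B : LinearMap.BilinForm R M} (hB : ∀ x, B x x = 0) :
    (-B).toQuadraticMap = (0 : QuadraticForm R M) - 0 := by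
  ext x; simp [hB]

/-- The alternating form sending a family of vectors to the Pfaffian of its Gram matrix. -/
noncomputable def pfaffianForm {B : LinearMap.BilinForm R M} (hB : ∀ x, B x x = 0) (N : ℕ) :
    M [⋀^Fin N]→ₗ[R] R :=
  ((ExteriorAlgebra.algebraMapInv : ExteriorAlgebra R M →ₐ[R] R).toLinearMap ∘ₗ
    CliffordAlgebra.changeForm (toQuadraticMap_neg_eq_zero_sub_zero hB)).compAlternatingMap
    (ExteriorAlgebra.ιMulti R N)

variable {B : LinearMap.BilinForm R M} (hB : ∀ x, B x x = 0)

theorem pfaffianForm_zero (v : Fin 0 → M) : pfaffianForm hB 0 v = 1 := by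
  simp only [pfaffianForm, LinearMap.compAlternatingMap_apply, LinearMap.comp_apply,
    ExteriorAlgebra.ιMulti_zero_apply]
  erw [CliffordAlgebra.changeForm_one]
  simp

/-- The change of form sends m ∧ x to m ∧ x' plus the contraction of x' by B m, where x' is the
image of x. Taking the constant term kills the wedge, and contraction commutes with the change of
form. This gives the first-row expansion of the Pfaffian. -/
theorem algebraMapInv_changeForm_ι_mul (m : M) (x : ExteriorAlgebra R M) :
    ExteriorAlgebra.algebraMapInv (CliffordAlgebra.changeForm
      (toQuadraticMap_neg_eq_zero_sub_zero hB) (ExteriorAlgebra.ι R m * x)) =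
    ExteriorAlgebra.algebraMapInv (CliffordAlgebra.changeForm
      (toQuadraticMap_neg_eq_zero_sub_zero hB)
        (CliffordAlgebra.contractLeft (Q := (0 : QuadraticForm R M)) (B m) x)) := by
  erw [CliffordAlgebra.changeForm_ι_mul, CliffordAlgebra.changeForm_contractLeft]
  erw [map_sub, map_mul]
  have : ExteriorAlgebra.algebraMapInv (ExteriorAlgebra.ι R m) = 0 := by
    simp [ExteriorAlgebra.algebraMapInv]
  erw [this]
  simp only [LinearMap.neg_apply, map_neg, zero_mul, zero_sub, neg_neg]

theorem pfaffianForm_one (v : Fin 1 → M) : pfaffianForm hB 1 v = 0 := by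
  simp only [pfaffianForm, LinearMap.compAlternatingMap_apply, LinearMap.comp_apply,
    ExteriorAlgebra.ιMulti_succ_apply]
  erw [algebraMapInv_changeForm_ι_mul hB]
  simp only [ExteriorAlgebra.ιMulti_zero_apply]
  erw [CliffordAlgebra.contractLeft_one]
  simp

theorem pfaffianForm_succ_succ (N : ℕ) (v : Fin (N + 2) → M) :
    pfaffianForm hB (N + 2) v = ∑ j : Fin (N + 1), (-1) ^ (j : ℕ) * B (v 0) (v j.succ) *
      pfaffianForm hB N (fun k => v (j.succAbove k).succ) := by
  simp only [pfaffianForm, LinearMap.compAlternatingMap_apply, LinearMap.comp_apply]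
  rw [ExteriorAlgebra.ιMulti_succ_apply]
  erw [algebraMapInv_changeForm_ι_mul hB, contractLeft_ιMulti]
  rw [map_sum, map_sum]
  refine Finset.sum_congr rfl fun j _ => ?_
  rw [map_smul, map_smul, smul_eq_mul]
  rfl

theorem pfaffianForm_eq_pfaffian : ∀ (N : ℕ) (v : Fin N → M),
    pfaffianForm hB N v = pfaffian N (Matrix.of fun i j => B (v i) (v j))
  | 0, v => by rw [pfaffianForm_zero, pfaffian]
  | 1, v => by rw [pfaffianForm_one, pfaffian]
  | N + 2, v => by
    rw [pfaffianForm_succ_succ, pfaffian]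
    refine Finset.sum_congr rfl fun j _ => ?_
    rw [pfaffianForm_eq_pfaffian N]
    rfl

end Pfaffian

/-! ### Pfaffian 1 implies invertibility -/

section Det

variable {R : Type*} [CommRing R]

theorem eq_zero_of_eq_neg (h2 : IsUnit (2 : R)) {x : R} (hx : x = -x) : x = 0 :=
  h2.mul_left_cancel (by linear_combination hx)

theorem dotProduct_mulVec_swap {N : ℕ} {φ : Matrix (Fin N) (Fin N) R} (hs : φᵀ = -φ)
    (x y : Fin N → R) : y ⬝ᵥ φ *ᵥ x = -(x ⬝ᵥ φ *ᵥ y) := by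
  rw [dotProduct_mulVec, ← mulVec_transpose, hs, neg_mulVec, neg_dotProduct, dotProduct_comm]

theorem isUnit_det_of_pfaffian_eq_one (h2 : IsUnit (2 : R)) {N : ℕ}
    {φ : Matrix (Fin N) (Fin N) R} (hs : φᵀ = -φ) (hpf : pfaffian N φ = 1) : IsUnit φ.det := by
  obtain _ | _ | N := N
  · simp
  · simp [pfaffian] at hpf
    have := subsingleton_of_zero_eq_one hpf
    exact isUnit_of_subsingleton _
  set B := Matrix.toBilin' φ with hBdef
  have hBapp : ∀ x y, B x y = x ⬝ᵥ φ *ᵥ y := fun x y => by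
    rw [hBdef, Matrix.toBilin'_apply']
  have hB : ∀ x, B x x = 0 := fun x => eq_zero_of_eq_neg h2 <| by
    simp only [hBapp]; exact dotProduct_mulVec_swap hs x x
  let e : Fin (N + 2) → Fin (N + 2) → R := fun i => Pi.single i 1
  have hF : pfaffianForm hB (N + 2) e = 1 := by
    rw [pfaffianForm_eq_pfaffian, ← hpf]
    congr 1
    ext i j
    simp [e, hBdef]
  -- Cramer's rule for the alternating form: the components of x along the other basis vectors
  -- produce a repeated argument.
  have hupd : ∀ k x, pfaffianForm hB (N + 2) (Function.update e k x) = x k := by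
    intro k x
    have hx : x = ∑ i, x i • e i := by
      ext j; simp [e, Finset.sum_apply, Pi.single_apply]
    conv_lhs => rw [hx, AlternatingMap.map_update_sum]
    rw [Finset.sum_eq_single k]
    · rw [AlternatingMap.map_update_smul, Function.update_eq_self, hF, smul_eq_mul, mul_one]
    · intro i _ hik
      rw [AlternatingMap.map_update_smul, AlternatingMap.map_update_self _ _ hik.symm, smul_zero]
    · simp
  -- With x in slot 0, the first-row expansion involves x only through its pairings with the other
  -- vectors, so it is linear in φ x. The vectors r are then the rows of a left inverse of φ.
  have hrow : ∀ k, ∃ r : Fin (N + 2) → R, ∀ x, x k = r ⬝ᵥ (φ *ᵥ x) := by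
    intro k
    suffices h : ∀ w : Fin (N + 2) → Fin (N + 2) → R, ∃ r : Fin (N + 2) → R, ∀ x,
        pfaffianForm hB (N + 2) (Function.update w 0 x) = r ⬝ᵥ (φ *ᵥ x) by
      by_cases hk : k = 0
      · subst hk
        obtain ⟨r, hr⟩ := h e
        exact ⟨r, fun x => by rw [← hr, hupd]⟩
      -- The expansion is available for slot 0 only, so slots 0 and k are exchanged at the cost of a
      -- sign.
      · obtain ⟨r, hr⟩ := h (e ∘ Equiv.swap 0 k)
        refine ⟨-r, fun x => ?_⟩
        rw [neg_dotProduct, ← hr, ← hupd k x,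
          ← AlternatingMap.map_swap _ _ (Ne.symm hk)]
        congr 1
        ext i : 1
        simp only [Function.comp_apply, Function.update_apply]
        by_cases h0 : i = 0
        · subst h0; simp [hk, Ne.symm hk]
        · by_cases h1 : i = k
          · subst h1; simp
          · simp [Equiv.swap_apply_of_ne_of_ne h0 h1, h0, h1]
    intro w
    refine ⟨-∑ j : Fin (N + 1), ((-1) ^ (j : ℕ) *
      pfaffianForm hB N (fun k => w (j.succAbove k).succ)) • w j.succ, fun x => ?_⟩
    rw [pfaffianForm_succ_succ, neg_dotProduct, sum_dotProduct, ← Finset.sum_neg_distrib]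
    refine Finset.sum_congr rfl fun j _ => ?_
    rw [smul_dotProduct, dotProduct_mulVec_swap hs]
    simp only [Function.update_self, ne_eq, Fin.succ_ne_zero, not_false_eq_true,
      Function.update_of_ne, hBapp, smul_eq_mul]
    ring
  choose r hr using hrow
  refine Matrix.isUnit_det_of_left_inverse (B := Matrix.of r) ?_
  ext k i
  have := hr k (Pi.single i 1)
  rw [mulVec_single_one] at this
  rw [mul_apply, Matrix.one_apply]
  simp only [Pi.single_apply] at this
  rw [this]; rfl

end Det

/-! ### Transvections and Eichler transformations -/

section Transvections

variable {R : Type*} [CommRing R] {N : ℕ}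

/-- The bilinear form `xᵗ φ y`. -/
def symForm (φ : Matrix (Fin N) (Fin N) R) (x y : Fin N → R) : R := x ⬝ᵥ φ *ᵥ y

section Form

variable (φ : Matrix (Fin N) (Fin N) R) (x y z : Fin N → R) (a : R)

theorem symForm_add_left : symForm φ (x + y) z = symForm φ x z + symForm φ y z :=
  add_dotProduct _ _ _

theorem symForm_sub_left : symForm φ (x - y) z = symForm φ x z - symForm φ y z :=
  sub_dotProduct _ _ _

theorem symForm_smul_left : symForm φ (a • x) z = a * symForm φ x z := smul_dotProduct _ _ _

theorem symForm_add_right : symForm φ x (y + z) = symForm φ x y + symForm φ x z := by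
  simp [symForm, mulVec_add]

theorem symForm_sub_right : symForm φ x (y - z) = symForm φ x y - symForm φ x z := by
  simp [symForm, mulVec_sub]

theorem symForm_neg_right : symForm φ x (-y) = -symForm φ x y := by
  simp [symForm, mulVec_neg]

theorem symForm_smul_right : symForm φ x (a • y) = a * symForm φ x y := by
  simp [symForm, mulVec_smul]

end Form

variable {φ : Matrix (Fin N) (Fin N) R}

theorem symForm_swap (hs : φᵀ = -φ) (x y : Fin N → R) : symForm φ y x = -symForm φ x y :=
  dotProduct_mulVec_swap hs x y

theorem symForm_self (h2 : IsUnit (2 : R)) (hs : φᵀ = -φ) (x : Fin N → R) : symForm φ x x = 0 :=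
  eq_zero_of_eq_neg h2 (symForm_swap hs x x)

theorem symForm_mulVec_mulVec {A : Matrix (Fin N) (Fin N) R} (hA : Aᵀ * φ * A = φ)
    (x y : Fin N → R) : symForm φ (A *ᵥ x) (A *ᵥ y) = symForm φ x y := by
  rw [symForm, symForm, ← vecMul_transpose, ← dotProduct_mulVec, mulVec_mulVec, mulVec_mulVec,
    hA]

/-- The symplectic transvection `z ↦ z + a ⟨x, z⟩ x`. -/
def longT (φ : Matrix (Fin N) (Fin N) R) (x : Fin N → R) (a : R) : Matrix (Fin N) (Fin N) R :=
  1 + a • vecMulVec x (x ᵥ* φ)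

/-- The Eichler transformation `z ↦ z + ⟨y, z⟩ x + ⟨x, z⟩ y`, an isometry when `⟨x, y⟩ = 0`. -/
def shortT (φ : Matrix (Fin N) (Fin N) R) (x y : Fin N → R) : Matrix (Fin N) (Fin N) R :=
  1 + vecMulVec x (y ᵥ* φ) + vecMulVec y (x ᵥ* φ)

theorem vecMulVec_vecMul_mulVec (x y z : Fin N → R) :
    vecMulVec x (y ᵥ* φ) *ᵥ z = symForm φ y z • x := by
  rw [vecMulVec_mulVec, ← dotProduct_mulVec, symForm]
  ext i; simp [mul_comm]

theorem longT_mulVec (x : Fin N → R) (a : R) (z : Fin N → R) :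
    longT φ x a *ᵥ z = z + (a * symForm φ x z) • x := by
  rw [longT, add_mulVec, one_mulVec, smul_mulVec, vecMulVec_vecMul_mulVec, smul_smul]

theorem shortT_mulVec (x y z : Fin N → R) :
    shortT φ x y *ᵥ z = z + symForm φ y z • x + symForm φ x z • y := by
  rw [shortT, add_mulVec, add_mulVec, one_mulVec, vecMulVec_vecMul_mulVec,
    vecMulVec_vecMul_mulVec]

theorem eq_of_mulVec_eq {A B : Matrix (Fin N) (Fin N) R} (h : ∀ z, A *ᵥ z = B *ᵥ z) : A = B :=
  Matrix.mulVec_injective (funext h)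

theorem shortT_comm (x y : Fin N → R) : shortT φ x y = shortT φ y x := by
  rw [shortT, shortT, add_right_comm]

theorem shortT_smul (x y : Fin N → R) (a : R) : shortT φ x (a • y) = shortT φ (a • x) y := by
  refine eq_of_mulVec_eq fun z => ?_
  simp only [shortT_mulVec, symForm_smul_left]
  module

theorem longT_zero (x : Fin N → R) : longT φ x 0 = 1 := by simp [longT]

theorem longT_add (h2 : IsUnit (2 : R)) (hs : φᵀ = -φ) (x : Fin N → R) (a b : R) :
    longT φ x (a + b) = longT φ x a * longT φ x b := by
  refine eq_of_mulVec_eq fun z => ?_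
  rw [← mulVec_mulVec]
  simp only [longT_mulVec, symForm_add_right, symForm_smul_right, symForm_self h2 hs]
  module

theorem shortT_mul_shortT (h2 : IsUnit (2 : R)) (hs : φᵀ = -φ) {x y z : Fin N → R}
    (hy : symForm φ x y = 0) (hz : symForm φ x z = 0) :
    shortT φ x y * shortT φ x z = shortT φ x (y + z) * longT φ x (symForm φ y z) := by
  refine eq_of_mulVec_eq fun v => ?_
  rw [← mulVec_mulVec, ← mulVec_mulVec]
  have hy' : symForm φ y x = 0 := by rw [symForm_swap hs, hy, neg_zero]
  have hz' : symForm φ z x = 0 := by rw [symForm_swap hs, hz, neg_zero]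
  simp only [longT_mulVec, shortT_mulVec, symForm_add_right, symForm_smul_right,
    symForm_add_left, symForm_self h2 hs, hz, hy', hz']
  module

/-- Heisenberg relation: Eichler transformations along x commute up to a transvection along x. This
is what extracts transvections from the generators. -/
theorem shortT_mul_shortT_comm (h2 : IsUnit (2 : R)) (hs : φᵀ = -φ) {x y z : Fin N → R}
    (hy : symForm φ x y = 0) (hz : symForm φ x z = 0) :
    shortT φ x y * shortT φ x z =
      longT φ x (2 * symForm φ y z) * (shortT φ x z * shortT φ x y) := by
  refine eq_of_mulVec_eq fun v => ?_
  simp only [← mulVec_mulVec]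
  have hy' : symForm φ y x = 0 := by rw [symForm_swap hs, hy, neg_zero]
  have hz' : symForm φ z x = 0 := by rw [symForm_swap hs, hz, neg_zero]
  simp only [longT_mulVec, shortT_mulVec, symForm_add_right, symForm_smul_right,
    symForm_self h2 hs, hy, hz, hy', hz', symForm_swap hs y z]
  module

theorem longT_add_left (h2 : IsUnit (2 : R)) (hs : φᵀ = -φ) {x y : Fin N → R} (a : R)
    (hxy : symForm φ x y = 0) :
    longT φ (x + y) a = longT φ x a * longT φ y a * shortT φ x (a • y) := by
  refine eq_of_mulVec_eq fun v => ?_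
  simp only [← mulVec_mulVec]
  have hyx : symForm φ y x = 0 := by rw [symForm_swap hs, hxy, neg_zero]
  simp only [longT_mulVec, shortT_mulVec, symForm_add_right, symForm_smul_right,
    symForm_add_left, symForm_smul_left, symForm_self h2 hs, hxy, hyx]
  module

theorem shortT_eq_longT_mul_longT (h2 : IsUnit (2 : R)) (hs : φᵀ = -φ) {x y : Fin N → R} (a : R)
    (hxy : symForm φ x y = 0) :
    shortT φ x ((2 * a) • y) = longT φ (x + y) a * longT φ (x - y) (-a) := by
  refine eq_of_mulVec_eq fun v => ?_
  simp only [← mulVec_mulVec]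
  have hyx : symForm φ y x = 0 := by rw [symForm_swap hs, hxy, neg_zero]
  simp only [longT_mulVec, shortT_mulVec, symForm_add_right, symForm_sub_right,
    symForm_smul_right, symForm_add_left, symForm_sub_left, symForm_smul_left,
    symForm_self h2 hs, hxy, hyx]
  module

theorem mul_longT {A : Matrix (Fin N) (Fin N) R} (hA : Aᵀ * φ * A = φ) (x : Fin N → R) (a : R) :
    A * longT φ x a = longT φ (A *ᵥ x) a * A := by
  refine eq_of_mulVec_eq fun v => ?_
  simp only [← mulVec_mulVec, longT_mulVec, mulVec_add, mulVec_smul, symForm_mulVec_mulVec hA]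

end Transvections

/-! ### Subgroup membership read on matrices -/

section Membership

variable {R : Type*} [CommRing R] {N : ℕ} {φ : Matrix (Fin N) (Fin N) R}

/-- The matrix `A` represents an element of the subgroup `G` of `Sp φ`. -/
def Represents (G : Subgroup (Sp φ)) (A : Matrix (Fin N) (Fin N) R) : Prop :=
  ∃ g ∈ G, ((g : GL (Fin N) R) : Matrix (Fin N) (Fin N) R) = A

theorem sp_ext {g h : Sp φ} (H : ((g : GL (Fin N) R) : Matrix (Fin N) (Fin N) R) =
    ((h : GL (Fin N) R) : Matrix (Fin N) (Fin N) R)) : g = h :=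
  Subtype.ext (Units.ext H)

variable {G E : Subgroup (Sp φ)} {A B K : Matrix (Fin N) (Fin N) R}

theorem Represents.mem {g : Sp φ} (h : Represents G (g : GL (Fin N) R)) : g ∈ G := by
  obtain ⟨g', hg', h⟩ := h
  rwa [← sp_ext h]

theorem Represents.one : Represents G 1 := ⟨1, G.one_mem, rfl⟩

theorem Represents.mul (hA : Represents G A) (hB : Represents G B) : Represents G (A * B) := by
  obtain ⟨a, ha, rfl⟩ := hA
  obtain ⟨b, hb, rfl⟩ := hB
  exact ⟨a * b, G.mul_mem ha hb, rfl⟩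

theorem Represents.of_mul_right (hB : Represents G B) (hAB : Represents G (A * B)) :
    Represents G A := by
  obtain ⟨b, hb, rfl⟩ := hB
  obtain ⟨c, hc, h⟩ := hAB
  refine ⟨c * b⁻¹, G.mul_mem hc (G.inv_mem hb), ?_⟩
  have h1 : (((c * b⁻¹ : Sp φ) : GL (Fin N) R) : Matrix (Fin N) (Fin N) R) =
    ((c : GL (Fin N) R) : Matrix _ _ R) * (((b⁻¹ : Sp φ) : GL (Fin N) R) : Matrix (Fin N) (Fin N) R) := rfl
  have h2 : ((b : GL (Fin N) R) : Matrix _ _ R) *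
      (((b⁻¹ : Sp φ) : GL (Fin N) R) : Matrix (Fin N) (Fin N) R) = 1 :=
    Units.mul_inv (b : GL (Fin N) R)
  rw [h1, h, Matrix.mul_assoc, h2, Matrix.mul_one]

/-- K is the commutator (A B A⁻¹) B⁻¹. Only B has to come from G, so with E absolute and G relative
only one factor needs coefficients in I. -/
theorem Represents.of_commutator (hnorm : ∀ e ∈ E, ∀ g ∈ G, e * g * e⁻¹ ∈ G)
    (hA : Represents E A) (hB : Represents G B) (h : A * B = K * (B * A)) : Represents G K := by
  obtain ⟨a, ha, rfl⟩ := hA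
  obtain ⟨b, hb, rfl⟩ := hB
  refine Represents.of_mul_right ⟨b, hb, rfl⟩ ⟨a * b * a⁻¹, hnorm a ha b hb, ?_⟩
  have h1 : (((a * b * a⁻¹ : Sp φ) : GL (Fin N) R) : Matrix (Fin N) (Fin N) R) =
    ((a : GL (Fin N) R) : Matrix _ _ R) * ((b : GL (Fin N) R) : Matrix _ _ R) *
      (((a⁻¹ : Sp φ) : GL (Fin N) R) : Matrix (Fin N) (Fin N) R) := rfl
  have h2 : ((a : GL (Fin N) R) : Matrix _ _ R) *
      (((a⁻¹ : Sp φ) : GL (Fin N) R) : Matrix (Fin N) (Fin N) R) = 1 :=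
    Units.mul_inv (a : GL (Fin N) R)
  rw [h1, h, Matrix.mul_assoc, Matrix.mul_assoc, h2, Matrix.mul_one]

end Membership

/-! ### Generating all transvections from a hyperbolic pair -/

section HyperbolicPair

variable {R : Type*} [CommRing R] {N : ℕ} {φ : Matrix (Fin N) (Fin N) R} {e u : Fin N → R}
  {G E : Subgroup (Sp φ)} {I : Ideal R}

theorem exists_two_mul_eq (h2 : IsUnit (2 : R)) {a : R} (ha : a ∈ I) : ∃ b ∈ I, 2 * b = a := by
  obtain ⟨t, ht⟩ := h2.exists_right_inv
  exact ⟨t * a, I.mul_mem_left _ ha, by linear_combination a * ht⟩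

/-- `G` contains the Eichler transformations with coefficients in `I` attached to the hyperbolic
pair `(e, u)` and the vectors orthogonal to both. -/
def ContainsEichler (e u : Fin N → R) (G : Subgroup (Sp φ)) (I : Ideal R) : Prop :=
  ∀ p : Fin N → R, symForm φ e p = 0 → symForm φ u p = 0 → ∀ a ∈ I,
    Represents G (shortT φ e (a • p)) ∧ Represents G (shortT φ u (a • p))

theorem ContainsEichler.longT_orthogonal (h2 : IsUnit (2 : R)) (hs : φᵀ = -φ)
    (hue : symForm φ u e = 1) (hnorm : ∀ e ∈ E, ∀ g ∈ G, e * g * e⁻¹ ∈ G)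
    (hE : ContainsEichler e u E ⊤) (hG : ContainsEichler e u G I) {p : Fin N → R}
    (hep : symForm φ e p = 0) (hup : symForm φ u p = 0) {a : R} (ha : a ∈ I) :
    Represents G (longT φ p a) := by
  obtain ⟨b, hb, rfl⟩ := exists_two_mul_eq h2 ha
  have hpe : symForm φ p e = 0 := by rw [symForm_swap hs, hep, neg_zero]
  have hpu : symForm φ p (b • u) = 0 := by
    rw [symForm_smul_right, symForm_swap hs, hup, neg_zero, mul_zero]
  have hE1 := (hE p hep hup 1 trivial).1
  rw [one_smul, shortT_comm] at hE1
  have hG1 := (hG p hep hup (-b) (I.neg_mem hb)).2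
  rw [shortT_comm, ← shortT_smul] at hG1
  -- Since ⟨e,u⟩ = -1, the choice z = -b u makes the commutator T_p(2b).
  have h := shortT_mul_shortT_comm (y := e) (z := (-b) • u) h2 hs hpe
    (by rw [neg_smul, symForm_neg_right, hpu, neg_zero])
  rw [symForm_smul_right, symForm_swap hs, hue, mul_neg_one, neg_neg] at h
  exact Represents.of_commutator hnorm hE1 hG1 h

theorem ContainsEichler.shortT_orthogonal (h2 : IsUnit (2 : R)) (hs : φᵀ = -φ)
    (hue : symForm φ u e = 1) (hnorm : ∀ e ∈ E, ∀ g ∈ G, e * g * e⁻¹ ∈ G)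
    (hE : ContainsEichler e u E ⊤) (hG : ContainsEichler e u G I) {p : Fin N → R}
    (hep : symForm φ e p = 0) (hup : symForm φ u p = 0) {a : R} (ha : a ∈ I) (r s : R) :
    Represents G (shortT φ p (a • (r • e + s • u))) := by
  have hpe : symForm φ p e = 0 := by rw [symForm_swap hs, hep, neg_zero]
  have hpu : symForm φ p u = 0 := by rw [symForm_swap hs, hup, neg_zero]
  have h := shortT_mul_shortT (φ := φ) (x := p) (y := (a * r) • e) (z := (a * s) • u) h2 hs
    (by rw [symForm_smul_right, hpe, mul_zero]) (by rw [symForm_smul_right, hpu, mul_zero])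
  rw [show a • (r • e + s • u) = (a * r) • e + (a * s) • u by module]
  -- The product of the transformations for e and u is the wanted one times a transvection along p,
  -- already known to lie in G.
  refine Represents.of_mul_right (hE.longT_orthogonal h2 hs hue hnorm hG hep hup (a := _) ?_)
    (h ▸ Represents.mul ?_ ?_)
  · rw [symForm_smul_left, mul_assoc]
    exact I.mul_mem_right _ ha
  · rw [shortT_smul, shortT_comm]
    exact (hG p hep hup _ (I.mul_mem_right _ ha)).1
  · rw [shortT_smul, shortT_comm]
    exact (hG p hep hup _ (I.mul_mem_right _ ha)).2

theorem ContainsEichler.longT_plane (h2 : IsUnit (2 : R)) (hs : φᵀ = -φ)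
    (hue : symForm φ u e = 1) (hnorm : ∀ e ∈ E, ∀ g ∈ G, e * g * e⁻¹ ∈ G)
    (hnorm' : ∀ e ∈ E, ∀ g ∈ E, e * g * e⁻¹ ∈ E)
    (hE : ContainsEichler e u E ⊤) (hG : ContainsEichler e u G I)
    (htop : Ideal.span {t : R | ∃ p q : Fin N → R, symForm φ e p = 0 ∧ symForm φ u p = 0 ∧
      symForm φ e q = 0 ∧ symForm φ u q = 0 ∧ symForm φ p q = t} = ⊤)
    {a : R} (ha : a ∈ I) (r s : R) : Represents G (longT φ (r • e + s • u) a) := by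
  set x := r • e + s • u with hx
  -- The t for which every T_x(bt), b in I, lies in G form an ideal; it contains each ⟨p,q⟩, hence
  -- 1.
  suffices h : ∀ t ∈ Ideal.span {t : R | ∃ p q : Fin N → R, symForm φ e p = 0 ∧
      symForm φ u p = 0 ∧ symForm φ e q = 0 ∧ symForm φ u q = 0 ∧ symForm φ p q = t},
      ∀ b ∈ I, Represents G (longT φ x (b * t)) by
    simpa using h 1 (htop ▸ trivial) a ha
  intro t ht
  induction ht using Submodule.span_induction with
  | mem t ht =>
    obtain ⟨p, q, hep, hup, heq, huq, rfl⟩ := ht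
    intro b' hb'
    obtain ⟨b, hb, rfl⟩ := exists_two_mul_eq h2 hb'
    have hxp : ∀ {p : Fin N → R}, symForm φ e p = 0 → symForm φ u p = 0 → symForm φ x p = 0 := by
      intro p hp hp'
      rw [hx, symForm_add_left, symForm_smul_left, symForm_smul_left, hp, hp']
      ring
    have h := shortT_mul_shortT_comm (x := x) (y := p) (z := b • q) h2 hs (hxp hep hup)
      (by rw [symForm_smul_right, hxp heq huq, mul_zero])
    rw [symForm_smul_right, ← mul_assoc (2 : R)] at h
    refine Represents.of_commutator hnorm ?_ ?_ h
    · have := hE.shortT_orthogonal h2 hs hue hnorm' hE hep hup (a := 1) trivial r s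
      rwa [one_smul, shortT_comm] at this
    · rw [shortT_smul, shortT_comm]
      exact hE.shortT_orthogonal h2 hs hue hnorm hG heq huq hb r s
  | zero => intro b _; rw [mul_zero, longT_zero]; exact Represents.one
  | add t t' _ _ h h' =>
    intro b hb
    rw [mul_add, longT_add h2 hs]
    exact (h b hb).mul (h' b hb)
  | smul c t _ h =>
    intro b hb
    rw [smul_eq_mul, ← mul_assoc]
    exact h _ (I.mul_mem_right _ hb)

theorem ContainsEichler.longT (h2 : IsUnit (2 : R)) (hs : φᵀ = -φ)
    (hue : symForm φ u e = 1) (hnorm : ∀ e ∈ E, ∀ g ∈ G, e * g * e⁻¹ ∈ G)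
    (hnorm' : ∀ e ∈ E, ∀ g ∈ E, e * g * e⁻¹ ∈ E)
    (hE : ContainsEichler e u E ⊤) (hG : ContainsEichler e u G I)
    (htop : Ideal.span {t : R | ∃ p q : Fin N → R, symForm φ e p = 0 ∧ symForm φ u p = 0 ∧
      symForm φ e q = 0 ∧ symForm φ u q = 0 ∧ symForm φ p q = t} = ⊤)
    {a : R} (ha : a ∈ I) (x : Fin N → R) : Represents G (longT φ x a) := by
  have heu : symForm φ e u = -1 := by rw [symForm_swap hs, hue]
  obtain ⟨r, s, p, hep, hup, rfl⟩ : ∃ (r s : R) (p : Fin N → R), symForm φ e p = 0 ∧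
      symForm φ u p = 0 ∧ p + (r • e + s • u) = x := by
    -- Coordinates of x in the hyperbolic plane; the remainder is orthogonal to e and u.
    refine ⟨symForm φ u x, -symForm φ e x,
      x - (symForm φ u x • e + (-symForm φ e x) • u), ?_, ?_, by abel⟩ <;>
    · simp only [symForm_sub_right, symForm_add_right, symForm_smul_right, symForm_self h2 hs,
        hue, heu]
      ring
  have hpe : symForm φ p e = 0 := by rw [symForm_swap hs, hep, neg_zero]
  have hpu : symForm φ p u = 0 := by rw [symForm_swap hs, hup, neg_zero]
  rw [longT_add_left h2 hs]
  · exact ((hE.longT_orthogonal h2 hs hue hnorm hG hep hup ha).mul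
      (hE.longT_plane h2 hs hue hnorm hnorm' hG htop ha r s)).mul
      (hE.shortT_orthogonal h2 hs hue hnorm hG hep hup ha r s)
  · simp only [symForm_add_right, symForm_smul_right, hpe, hpu]
    ring

/-- In rank at least four, the pairings between vectors orthogonal to a hyperbolic pair generate
the unit ideal. -/
theorem span_symForm_orthogonal_eq_top (h2 : IsUnit (2 : R)) (hs : φᵀ = -φ) (hu : IsUnit φ.det)
    (hN : 2 < N) (hue : symForm φ u e = 1) :
    Ideal.span {t : R | ∃ p q : Fin N → R, symForm φ e p = 0 ∧ symForm φ u p = 0 ∧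
      symForm φ e q = 0 ∧ symForm φ u q = 0 ∧ symForm φ p q = t} = ⊤ := by
  have heu : symForm φ e u = -1 := by rw [symForm_swap hs, hue]
  set J := Ideal.span {t : R | ∃ p q : Fin N → R, symForm φ e p = 0 ∧ symForm φ u p = 0 ∧
      symForm φ e q = 0 ∧ symForm φ u q = 0 ∧ symForm φ p q = t} with hJ
  by_contra hne
  have : Nontrivial (R ⧸ J) := Ideal.Quotient.nontrivial_iff.mpr hne
  let b : Fin N → Fin N → R := fun i => Pi.single i 1
  let ψ := φ.map (Ideal.Quotient.mk J)
  let P : Matrix (Fin N) (Fin 2) (R ⧸ J) := Matrix.of fun i =>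
    ![Ideal.Quotient.mk J (symForm φ u (b i)), Ideal.Quotient.mk J (symForm φ e (b i))]
  let Q : Matrix (Fin 2) (Fin N) (R ⧸ J) := Matrix.of
    ![fun j => Ideal.Quotient.mk J (symForm φ e (b j)),
      fun j => -Ideal.Quotient.mk J (symForm φ u (b j))]
  -- Modulo J the components of the basis vectors orthogonal to e and u pair to zero, so only the
  -- plane contributes: φ mod J factors through rank 2, although it is invertible of size N > 2.
  have hψ : ψ = P * Q := by
    ext i j
    have hmem : symForm φ (b i) (b j) - (symForm φ u (b i) * symForm φ e (b j) -
        symForm φ e (b i) * symForm φ u (b j)) ∈ J := by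
      refine Ideal.subset_span ⟨b i - symForm φ u (b i) • e + symForm φ e (b i) • u,
        b j - symForm φ u (b j) • e + symForm φ e (b j) • u, ?_, ?_, ?_, ?_, ?_⟩
      all_goals
        simp only [symForm_sub_right, symForm_add_right, symForm_smul_right, symForm_sub_left,
          symForm_add_left, symForm_smul_left, symForm_self h2 hs, hue, heu,
          symForm_swap hs u (b i), symForm_swap hs e (b i)]
        ring
    have hij : symForm φ (b i) (b j) = φ i j := by simp [symForm, b]
    rw [hij] at hmem
    have := Ideal.Quotient.mk_eq_mk_iff_sub_mem _ _ |>.mpr hmem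
    simp only [ψ, P, Q, mul_apply, Fin.sum_univ_two, map_apply, this]
    simp [sub_eq_add_neg]
  have hrank : ψ.rank = N := by
    rw [rank_of_isUnit, Fintype.card_fin]
    rw [isUnit_iff_isUnit_det]
    have := hu.map (Ideal.Quotient.mk J)
    rwa [RingHom.map_det] at this
  have hle : ψ.rank ≤ 2 := hψ ▸ (rank_mul_le_left P Q).trans (rank_le_width P)
  omega

end HyperbolicPair

/-! ### The generators as Eichler transformations -/

section Generators

variable {R : Type*} [CommRing R] {l : ℕ} {φ : Matrix (Fin (l + 1)) (Fin (l + 1)) R}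

theorem apply_zero_zero (h2 : IsUnit (2 : R)) (hs : φᵀ = -φ) : φ 0 0 = 0 :=
  eq_zero_of_eq_neg h2 (congrFun (congrFun hs 0) 0)

theorem blockNu_transpose (hs : φᵀ = -φ) : (blockNu φ)ᵀ = -blockNu φ := by
  ext i j
  exact congrFun (congrFun hs i.succ) j.succ

theorem blockMu_transpose (hs : φᵀ = -φ) (hu : IsUnit φ.det) :
    (blockMu φ)ᵀ = -blockMu φ := by
  ext i j
  exact congrFun (congrFun (inv_skew hs hu) i.succ) j.succ

theorem mulVec_vecCons (h2 : IsUnit (2 : R)) (hs : φᵀ = -φ) (a : R) (x : Fin l → R) :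
    φ *ᵥ vecCons a x = vecCons (-(colC φ ⬝ᵥ x)) (a • colC φ + blockNu φ *ᵥ x) := by
  have hsk : ∀ i j, φ j i = - φ i j := fun i j => congrFun (congrFun hs i) j
  ext i
  rw [mulVec, dotProduct, Fin.sum_univ_succ]
  refine Fin.cases ?_ (fun i => ?_) i
  · simp [apply_zero_zero h2 hs, colC, dotProduct, hsk 0]
  · simp [colC, blockNu, mulVec, dotProduct, mul_comm]

theorem inv_mulVec_vecCons (h2 : IsUnit (2 : R)) (hs : φᵀ = -φ) (hu : IsUnit φ.det) (a : R)
    (x : Fin l → R) :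
    φ⁻¹ *ᵥ vecCons a x = vecCons (colD φ ⬝ᵥ x) (-a • colD φ + blockMu φ *ᵥ x) := by
  have hsk : ∀ i j, φ⁻¹ j i = - φ⁻¹ i j := fun i j => congrFun (congrFun (inv_skew hs hu) i) j
  ext i
  rw [mulVec, dotProduct, Fin.sum_univ_succ]
  refine Fin.cases ?_ (fun i => ?_) i
  · simp [apply_zero_zero h2 (inv_skew hs hu), colD, dotProduct]
  · simp [colD, blockMu, mulVec, dotProduct, mul_comm, hsk 0]

/-- Both parts of φ φ⁻¹ = 1 applied to (a, x); the choices a = 0, 1 and x = 0 give the identities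
between blocks. -/
theorem block_relations (h2 : IsUnit (2 : R)) (hs : φᵀ = -φ) (hu : IsUnit φ.det) (a : R)
    (x : Fin l → R) :
    colC φ ⬝ᵥ (a • colD φ - blockMu φ *ᵥ x) = a ∧
    (colD φ ⬝ᵥ x) • colC φ + blockNu φ *ᵥ (-a • colD φ + blockMu φ *ᵥ x) = x := by
  have h : φ *ᵥ (φ⁻¹ *ᵥ vecCons a x) = vecCons a x := by
    rw [mulVec_mulVec, mul_nonsing_inv _ hu, one_mulVec]
  rw [inv_mulVec_vecCons h2 hs hu, mulVec_vecCons h2 hs] at h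
  obtain ⟨h0, h1⟩ := Matrix.vecCons_inj.mp h
  refine ⟨?_, h1⟩
  refine Eq.trans ?_ h0
  rw [← dotProduct_neg]
  congr 1
  module

theorem colC_dotProduct_colD (h2 : IsUnit (2 : R)) (hs : φᵀ = -φ) (hu : IsUnit φ.det) :
    colC φ ⬝ᵥ colD φ = 1 := by
  simpa using (block_relations h2 hs hu 1 0).1

theorem colC_dotProduct_blockMu_mulVec (h2 : IsUnit (2 : R)) (hs : φᵀ = -φ) (hu : IsUnit φ.det)
    (x : Fin l → R) : colC φ ⬝ᵥ blockMu φ *ᵥ x = 0 := by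
  simpa using (block_relations h2 hs hu 0 x).1

theorem blockNu_mulVec_colD (h2 : IsUnit (2 : R)) (hs : φᵀ = -φ) (hu : IsUnit φ.det) :
    blockNu φ *ᵥ colD φ = 0 := by
  simpa [mulVec_neg] using (block_relations h2 hs hu 1 0).2

theorem blockMu_mulVec_blockNu_mulVec (h2 : IsUnit (2 : R)) (hs : φᵀ = -φ) (hu : IsUnit φ.det)
    (x : Fin l → R) :
    blockMu φ *ᵥ blockNu φ *ᵥ x = x - (colC φ ⬝ᵥ x) • colD φ := by
  have h : φ⁻¹ *ᵥ (φ *ᵥ vecCons 0 x) = vecCons 0 x := by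
    rw [mulVec_mulVec, nonsing_inv_mul _ hu, one_mulVec]
  rw [mulVec_vecCons h2 hs, inv_mulVec_vecCons h2 hs hu] at h
  have := (Matrix.vecCons_inj.mp h).2
  rw [neg_neg, zero_smul, zero_add] at this
  exact eq_sub_of_add_eq' this

theorem symForm_vecCons (h2 : IsUnit (2 : R)) (hs : φᵀ = -φ) (a b : R) (x y : Fin l → R) :
    symForm φ (vecCons a x) (vecCons b y) =
      b * (x ⬝ᵥ colC φ) + x ⬝ᵥ blockNu φ *ᵥ y - a * (colC φ ⬝ᵥ y) := by
  rw [symForm, mulVec_vecCons h2 hs, cons_dotProduct_cons, dotProduct_add, dotProduct_smul,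
    smul_eq_mul]
  ring

theorem elemC_mulVec (v : Fin l → R) (a : R) (z : Fin l → R) :
    elemC φ v *ᵥ vecCons a z =
      vecCons a (a • v + z + (v ⬝ᵥ blockNu φ *ᵥ z) • colD φ) := by
  have h : alpha φ v *ᵥ z = z + (v ⬝ᵥ blockNu φ *ᵥ z) • colD φ := by
    rw [alpha, add_mulVec, one_mulVec, ← mulVec_mulVec, vecMulVec_mulVec]
    ext i; simp [mul_comm]
  rw [add_assoc, ← h]
  ext i
  rw [mulVec, dotProduct, Fin.sum_univ_succ]
  refine Fin.cases ?_ (fun i => ?_) i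
  · simp [elemC]
  · simp [elemC, mulVec, dotProduct, mul_comm]

theorem elemR_mulVec (v : Fin l → R) (a : R) (z : Fin l → R) :
    elemR φ v *ᵥ vecCons a z =
      vecCons (a + v ⬝ᵥ z) (z + (colC φ ⬝ᵥ z) • blockMu φ *ᵥ v) := by
  have h : beta φ v *ᵥ z = z + (colC φ ⬝ᵥ z) • blockMu φ *ᵥ v := by
    rw [beta, add_mulVec, one_mulVec, ← mulVec_mulVec, vecMulVec_mulVec, ← mulVec_smul]
    congr 2
    ext i; simp [mul_comm]
  rw [← h]
  ext i
  rw [mulVec, dotProduct, Fin.sum_univ_succ]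
  refine Fin.cases ?_ (fun i => ?_) i
  · simp [elemR, dotProduct]
  · simp [elemR, mulVec, dotProduct]

/-- The first vector of the hyperbolic pair attached to `φ`. -/
def vecE (R : Type*) [CommRing R] (l : ℕ) : Fin (l + 1) → R := vecCons 1 0

/-- The second vector of the hyperbolic pair attached to `φ`. -/
noncomputable def vecU (φ : Matrix (Fin (l + 1)) (Fin (l + 1)) R) : Fin (l + 1) → R :=
  vecCons 0 (colD φ)

theorem symForm_vecE (h2 : IsUnit (2 : R)) (hs : φᵀ = -φ) (b : R) (y : Fin l → R) :
    symForm φ (vecE R l) (vecCons b y) = -(colC φ ⬝ᵥ y) := by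
  rw [vecE, symForm_vecCons h2 hs]; simp

theorem colD_dotProduct_blockNu_mulVec (h2 : IsUnit (2 : R)) (hs : φᵀ = -φ)
    (hu : IsUnit φ.det) (y : Fin l → R) : colD φ ⬝ᵥ blockNu φ *ᵥ y = 0 := by
  rw [dotProduct_mulVec_swap (blockNu_transpose hs), blockNu_mulVec_colD h2 hs hu,
    dotProduct_zero, neg_zero]

theorem symForm_vecU (h2 : IsUnit (2 : R)) (hs : φᵀ = -φ) (hu : IsUnit φ.det) (b : R)
    (y : Fin l → R) : symForm φ (vecU φ) (vecCons b y) = b := by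
  rw [vecU, symForm_vecCons h2 hs, dotProduct_comm (colD φ), colC_dotProduct_colD h2 hs hu,
    colD_dotProduct_blockNu_mulVec h2 hs hu]
  ring

theorem eq_of_mulVec_vecCons_eq {A B : Matrix (Fin (l + 1)) (Fin (l + 1)) R}
    (h : ∀ a z, A *ᵥ vecCons a z = B *ᵥ vecCons a z) : A = B :=
  eq_of_mulVec_eq fun z => by rw [← cons_head_tail z]; exact h _ _

/-- On (a, z) the Eichler factor adds ⟨(0,v),(a,z)⟩u, which exceeds the term in C_φ(v) by a(v·c)u;
the transvection removes this excess. -/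
theorem elemC_eq (h2 : IsUnit (2 : R)) (hs : φᵀ = -φ) (hu : IsUnit φ.det) (v : Fin l → R) :
    elemC φ v = shortT φ (vecU φ) (vecCons 0 v) * longT φ (vecU φ) (-(v ⬝ᵥ colC φ)) := by
  refine eq_of_mulVec_vecCons_eq fun a z => ?_
  rw [← mulVec_mulVec, longT_mulVec, symForm_vecU h2 hs hu, shortT_mulVec, elemC_mulVec]
  simp only [symForm_add_right, symForm_smul_right, symForm_vecU h2 hs hu,
    symForm_self h2 hs]
  rw [vecU, symForm_vecCons h2 hs, symForm_vecCons h2 hs, blockNu_mulVec_colD h2 hs hu]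
  simp only [smul_cons, cons_add_cons, dotProduct_zero, smul_eq_mul, zero_mul, mul_zero, sub_zero,
    add_zero]
  congr 1
  module

theorem elemR_eq (h2 : IsUnit (2 : R)) (hs : φᵀ = -φ) (hu : IsUnit φ.det) (v : Fin l → R) :
    elemR φ v = shortT φ (vecE R l) (vecCons 0 (-(blockMu φ *ᵥ v))) *
      longT φ (vecE R l) (-(v ⬝ᵥ colD φ)) := by
  refine eq_of_mulVec_vecCons_eq fun a z => ?_
  have h1 : (blockMu φ *ᵥ v) ⬝ᵥ blockNu φ *ᵥ z = (colC φ ⬝ᵥ z) * (v ⬝ᵥ colD φ) - v ⬝ᵥ z := by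
    rw [dotProduct_comm, dotProduct_mulVec_swap (blockMu_transpose hs hu),
      blockMu_mulVec_blockNu_mulVec h2 hs hu, dotProduct_sub, dotProduct_smul, smul_eq_mul]
    ring
  rw [← mulVec_mulVec, longT_mulVec, symForm_vecE h2 hs, shortT_mulVec, elemR_mulVec]
  simp only [symForm_add_right, symForm_smul_right, symForm_vecE h2 hs, symForm_self h2 hs]
  rw [vecE, symForm_vecCons h2 hs, symForm_vecCons h2 hs]
  simp only [neg_dotProduct, h1, dotProduct_comm (blockMu φ *ᵥ v) (colC φ),
    colC_dotProduct_blockMu_mulVec h2 hs hu, mulVec_zero, dotProduct_zero]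
  simp only [smul_cons, cons_add_cons, smul_eq_mul, zero_mul, mul_zero, sub_zero,
    add_zero]
  congr 1
  · ring
  · module

theorem shortT_vecU (h2 : IsUnit (2 : R)) (hs : φᵀ = -φ) (hu : IsUnit φ.det) {p : Fin l → R}
    (hp : colC φ ⬝ᵥ p = 0) : shortT φ (vecU φ) (vecCons 0 p) = elemC φ p := by
  rw [elemC_eq h2 hs hu, dotProduct_comm, hp, neg_zero, longT_zero, Matrix.mul_one]

/-- The condition c·p = 0 says that p is orthogonal to e. It gives μνp = p, and d·νp = 0 makes the
transvection factor trivial. -/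
theorem shortT_vecE (h2 : IsUnit (2 : R)) (hs : φᵀ = -φ) (hu : IsUnit φ.det) {p : Fin l → R}
    (hp : colC φ ⬝ᵥ p = 0) :
    shortT φ (vecE R l) (vecCons 0 p) = elemR φ (-(blockNu φ *ᵥ p)) := by
  rw [elemR_eq h2 hs hu, mulVec_neg, blockMu_mulVec_blockNu_mulVec h2 hs hu, hp, neg_dotProduct,
    dotProduct_comm, colD_dotProduct_blockNu_mulVec h2 hs hu]
  simp [longT_zero]

end Generators

/-! ### The normal group generated by transvections -/

section Groups

variable {R : Type*} [CommRing R] {l : ℕ} {φ : Matrix (Fin (l + 1)) (Fin (l + 1)) R}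

theorem containsEichler_of_generators (h2 : IsUnit (2 : R)) (hs : φᵀ = -φ) (hu : IsUnit φ.det)
    {G : Subgroup (Sp φ)} {I : Ideal R}
    (hG : ∀ v : Fin l → R, (∀ i, v i ∈ I) → Represents G (elemC φ v) ∧ Represents G (elemR φ v)) :
    ContainsEichler (vecE R l) (vecU φ) G I := by
  intro p hep hup a ha
  rw [← cons_head_tail p] at hep hup ⊢
  rw [symForm_vecE h2 hs, neg_eq_zero] at hep
  rw [symForm_vecU h2 hs hu] at hup
  rw [hup, smul_cons, smul_zero, shortT_vecU h2 hs hu, shortT_vecE h2 hs hu]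
  · refine ⟨(hG _ fun i => ?_).2, (hG _ fun i => ?_).1⟩
    · rw [mulVec_smul]
      exact I.neg_mem (I.mul_mem_right _ ha)
    · exact I.mul_mem_right _ ha
  all_goals rw [dotProduct_smul, hep, smul_zero]

theorem isometry (g : Sp φ) : ((g : GL (Fin (l + 1)) R) : Matrix (Fin (l + 1)) (Fin (l + 1)) R)ᵀ *
    φ * ((g : GL (Fin (l + 1)) R) : Matrix (Fin (l + 1)) (Fin (l + 1)) R) = φ := g.2

/-- The normal subgroup of `Sp φ` generated by the symplectic transvections with coefficient
in `I`. -/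
def transvectionGroup (φ : Matrix (Fin (l + 1)) (Fin (l + 1)) R) (I : Ideal R) :
    Subgroup (Sp φ) :=
  Subgroup.normalClosure {g : Sp φ | ∃ (x : Fin (l + 1) → R), ∃ a ∈ I,
    ((g : GL (Fin (l + 1)) R) : Matrix _ _ R) = longT φ x a}

instance (I : Ideal R) : (transvectionGroup φ I).Normal := Subgroup.normalClosure_normal

theorem transvectionGroup_le {I : Ideal R} {G : Subgroup (Sp φ)}
    (h : ∀ x, ∀ a ∈ I, Represents G (longT φ x a)) : transvectionGroup φ I ≤ G := by
  refine (Subgroup.closure_le G).mpr fun k hk => ?_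
  obtain ⟨g, ⟨x, a, ha, hg⟩, hk⟩ := Group.mem_conjugatesOfSet_iff.mp hk
  obtain ⟨c, rfl⟩ := isConj_iff.mp hk
  refine Represents.mem ?_
  convert h (((c : GL (Fin (l + 1)) R) : Matrix _ _ R) *ᵥ x) a ha using 1
  have h1 : (((c * g * c⁻¹ : Sp φ) : GL (Fin (l + 1)) R) : Matrix (Fin (l + 1)) (Fin (l + 1)) R) =
    ((c : GL (Fin (l + 1)) R) : Matrix _ _ R) * ((g : GL (Fin (l + 1)) R) : Matrix _ _ R) *
      (((c⁻¹ : Sp φ) : GL (Fin (l + 1)) R) : Matrix _ _ R) := rfl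
  have h2 : ((c : GL (Fin (l + 1)) R) : Matrix _ _ R) *
      (((c⁻¹ : Sp φ) : GL (Fin (l + 1)) R) : Matrix (Fin (l + 1)) (Fin (l + 1)) R) = 1 :=
    Units.mul_inv (c : GL (Fin (l + 1)) R)
  rw [h1, hg, mul_longT (isometry c), Matrix.mul_assoc, h2, Matrix.mul_one]

theorem longT_isometry (h2 : IsUnit (2 : R)) (hs : φᵀ = -φ) (x : Fin (l + 1) → R) (a : R) :
    (longT φ x a)ᵀ * φ * longT φ x a = φ := by
  -- The adjoint of T_x(a) with respect to φ is T_x(-a), its inverse.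
  have h : φ * longT φ x a = (longT φ x (-a))ᵀ * φ := by
    have hx : (x ᵥ* φ) = -(φ *ᵥ x) := by
      rw [← mulVec_transpose, hs, neg_mulVec]
    rw [longT, longT, mul_add, mul_one, transpose_add, add_mul, transpose_one, one_mul,
      transpose_smul, transpose_vecMulVec, mul_smul_comm, smul_mul_assoc, mul_vecMulVec,
      vecMulVec_mul, hx, vecMulVec_neg, vecMulVec_neg]
    simp
  rw [Matrix.mul_assoc, h, ← Matrix.mul_assoc, ← transpose_mul, ← longT_add h2 hs,
    neg_add_cancel, longT_zero, transpose_one, Matrix.one_mul]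

theorem represents_transvectionGroup (h2 : IsUnit (2 : R)) (hs : φᵀ = -φ) (hu : IsUnit φ.det)
    {I : Ideal R} (x : Fin (l + 1) → R) {a : R} (ha : a ∈ I) :
    Represents (transvectionGroup φ I) (longT φ x a) := by
  obtain ⟨g, hg⟩ := exists_Sp_of_isometry hu _ (longT_isometry h2 hs x a)
  exact ⟨g, Subgroup.subset_normalClosure ⟨x, a, ha, hg⟩, hg⟩

theorem represents_transvectionGroup_shortT_smul (h2 : IsUnit (2 : R)) (hs : φᵀ = -φ)
    (hu : IsUnit φ.det) {I : Ideal R} {x y : Fin (l + 1) → R} (hxy : symForm φ x y = 0) {a : R}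
    (ha : a ∈ I) : Represents (transvectionGroup φ I) (shortT φ x (a • y)) := by
  obtain ⟨b, hb, rfl⟩ := exists_two_mul_eq h2 ha
  rw [shortT_eq_longT_mul_longT h2 hs b hxy]
  exact (represents_transvectionGroup h2 hs hu _ hb).mul
    (represents_transvectionGroup h2 hs hu _ (I.neg_mem hb))

/-- A vector with entries in I need not be a single multiple a y with a in I, so the one-term case
is summed; each addition costs a transvection along x with coefficient in I. -/
theorem represents_transvectionGroup_shortT (h2 : IsUnit (2 : R)) (hs : φᵀ = -φ)
    (hu : IsUnit φ.det) {I : Ideal R} {ι : Type*} (s : Finset ι) {x : Fin (l + 1) → R}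
    {w : ι → Fin (l + 1) → R} (hw : ∀ i, symForm φ x (w i) = 0) {a : ι → R} (ha : ∀ i, a i ∈ I) :
    Represents (transvectionGroup φ I) (shortT φ x (∑ i ∈ s, a i • w i)) := by
  classical
  induction s using Finset.induction_on with
  | empty =>
    rw [Finset.sum_empty, ← zero_smul R (0 : Fin (l + 1) → R)]
    exact represents_transvectionGroup_shortT_smul h2 hs hu (by simp [symForm])
      (zero_mem _)
  | insert j s hj ih =>
    have hsum : symForm φ x (∑ i ∈ s, a i • w i) = 0 := by
      rw [symForm, mulVec_sum, dotProduct_sum]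
      refine Finset.sum_eq_zero fun i _ => ?_
      change symForm φ x (a i • w i) = 0
      rw [symForm_smul_right, hw, mul_zero]
    rw [Finset.sum_insert hj]
    refine Represents.of_mul_right (represents_transvectionGroup h2 hs hu x (a := _) ?_)
      (shortT_mul_shortT h2 hs (x := x) (y := a j • w j) ?_ hsum ▸ Represents.mul ?_ ih)
    · rw [symForm_smul_left]
      exact I.mul_mem_right _ (ha j)
    · rw [symForm_smul_right, hw, mul_zero]
    · exact represents_transvectionGroup_shortT_smul h2 hs hu (hw j) (ha j)

end Groups

/-! ### Identification of the relative group and normality -/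

section Normality

variable {R : Type*} [CommRing R] {l : ℕ} {φ : Matrix (Fin (l + 1)) (Fin (l + 1)) R}

theorem represents_transvectionGroup_elem (h2 : IsUnit (2 : R)) (hs : φᵀ = -φ)
    (hu : IsUnit φ.det) {I : Ideal R} {v : Fin l → R} (hv : ∀ i, v i ∈ I) :
    Represents (transvectionGroup φ I) (elemC φ v) ∧
      Represents (transvectionGroup φ I) (elemR φ v) := by
  have hdot : ∀ w : Fin l → R, -(v ⬝ᵥ w) ∈ I := fun w =>
    I.neg_mem (I.sum_mem fun i _ => I.mul_mem_right _ (hv i))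
  have hsum : v = ∑ i, v i • Pi.single i (1 : R) := by
    ext j; simp [Finset.sum_apply, Pi.single_apply]
  have hcons : ∀ A : Matrix (Fin l) (Fin l) R, (vecCons 0 (A *ᵥ v) : Fin (l + 1) → R) =
      ∑ i, v i • vecCons 0 (A *ᵥ Pi.single i 1) := by
    intro A
    ext j
    conv_lhs => rw [hsum, mulVec_sum]
    refine Fin.cases ?_ (fun j => ?_) j <;> simp [Finset.sum_apply, mulVec_smul]
  constructor
  · rw [elemC_eq h2 hs hu, ← one_mulVec v, hcons]
    refine Represents.mul (represents_transvectionGroup_shortT h2 hs hu _ (fun i => ?_) hv)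
      (represents_transvectionGroup h2 hs hu _ (by rw [one_mulVec]; exact hdot _))
    rw [symForm_vecU h2 hs hu]
  · rw [elemR_eq h2 hs hu, ← neg_mulVec, hcons]
    refine Represents.mul (represents_transvectionGroup_shortT h2 hs hu _ (fun i => ?_) hv)
      (represents_transvectionGroup h2 hs hu _ (hdot _))
    rw [symForm_vecE h2 hs, neg_mulVec, dotProduct_neg, neg_neg,
      colC_dotProduct_blockMu_mulVec h2 hs hu]

theorem represents_ESpIdeal (h2 : IsUnit (2 : R)) (hs : φᵀ = -φ) (hu : IsUnit φ.det)
    {I : Ideal R} {v : Fin l → R} (hv : ∀ i, v i ∈ I) :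
    Represents (ESpIdeal φ I) (elemC φ v) ∧ Represents (ESpIdeal φ I) (elemR φ v) := by
  obtain ⟨g, hg⟩ := exists_Sp_elemC h2 hs hu v
  obtain ⟨k, hk⟩ := exists_Sp_elemR h2 hs hu v
  exact ⟨⟨g, Subgroup.subset_closure ⟨v, hv, .inl hg⟩, hg⟩,
    ⟨k, Subgroup.subset_closure ⟨v, hv, .inr hk⟩, hk⟩⟩

theorem ESpIdeal_le_of_represents {I : Ideal R} {G : Subgroup (Sp φ)}
    (hG : ∀ v : Fin l → R, (∀ i, v i ∈ I) → Represents G (elemC φ v) ∧ Represents G (elemR φ v)) :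
    ESpIdeal φ I ≤ G := by
  refine (Subgroup.closure_le G).mpr ?_
  rintro g ⟨v, hv, hg | hg⟩
  · exact Represents.mem (hg ▸ (hG v hv).1)
  · exact Represents.mem (hg ▸ (hG v hv).2)

theorem ESpIdeal_top : ESpIdeal φ ⊤ = ESp φ := by
  simp [ESpIdeal, ESp]

theorem ESpIdeal_le_ESp (I : Ideal R) : ESpIdeal φ I ≤ ESp φ := by
  rw [← ESpIdeal_top]
  exact Subgroup.closure_mono fun g ⟨v, _, hg⟩ => ⟨v, fun _ => trivial, hg⟩

theorem ESpIdeal_le_relESp (I : Ideal R) : ESpIdeal φ I ≤ relESp φ I := fun g hg =>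
  ⟨⟨g, ESpIdeal_le_ESp I hg⟩, Subgroup.subset_normalClosure hg, rfl⟩

theorem relESp_conj_mem (I : Ideal R) :
    ∀ e ∈ ESp φ, ∀ g ∈ relESp φ I, e * g * e⁻¹ ∈ relESp φ I := by
  intro e he k hk
  obtain ⟨g, hg, rfl⟩ := Subgroup.mem_map.mp hk
  have h := Subgroup.normalClosure_normal.conj_mem g hg ⟨e, he⟩
  exact Subgroup.mem_map.mpr ⟨_, h, by simp only [map_mul, map_inv, Subgroup.subtype_apply]⟩

/-- The left side is normalized a priori only by `ESp φ`. That suffices for the commutator argument,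
and the right side is normal in all of `Sp φ`. -/
theorem relESp_eq_transvectionGroup (h2 : IsUnit (2 : R)) (hs : φᵀ = -φ) (hu : IsUnit φ.det)
    (hl : 2 < l + 1) (I : Ideal R) : relESp φ I = transvectionGroup φ I := by
  apply le_antisymm
  · rw [relESp, Subgroup.map_le_iff_le_comap]
    have : ((transvectionGroup φ I).comap (ESp φ).subtype).Normal := inferInstance
    refine Subgroup.normalClosure_le_normal fun g hg => ?_
    exact ESpIdeal_le_of_represents
      (fun v hv => represents_transvectionGroup_elem h2 hs hu hv) hg
  · have hue : symForm φ (vecU φ) (vecE R l) = 1 := symForm_vecU h2 hs hu _ _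
    refine transvectionGroup_le fun x a ha =>
      ContainsEichler.longT (E := ESp φ) h2 hs hue (relESp_conj_mem I)
        (fun e he g hg => mul_mem (mul_mem he hg) (inv_mem he))
        (containsEichler_of_generators h2 hs hu fun v hv => ?_)
        (containsEichler_of_generators h2 hs hu fun v hv => ?_)
        (span_symForm_orthogonal_eq_top h2 hs hu hl hue) ha x
    · rw [← ESpIdeal_top]
      exact represents_ESpIdeal h2 hs hu hv
    · obtain ⟨⟨g, hg, hg'⟩, k, hk, hk'⟩ := represents_ESpIdeal h2 hs hu hv
      exact ⟨⟨g, ESpIdeal_le_relESp I hg, hg'⟩, k, ESpIdeal_le_relESp I hk, hk'⟩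

theorem relESp_normal (h2 : IsUnit (2 : R)) (hs : φᵀ = -φ) (hu : IsUnit φ.det)
    (hl : 2 < l + 1) (I : Ideal R) : (relESp φ I).Normal := by
  rw [relESp_eq_transvectionGroup h2 hs hu hl]
  infer_instance

theorem ESp_normal (h2 : IsUnit (2 : R)) (hs : φᵀ = -φ) (hu : IsUnit φ.det)
    (hl : 2 < l + 1) : (ESp φ).Normal := by
  have h : relESp φ ⊤ = ESp φ :=
    le_antisymm (Subgroup.map_subtype_le _) (by rw [← ESpIdeal_top]; exact ESpIdeal_le_relESp ⊤)
  exact h ▸ relESp_normal h2 hs hu hl ⊤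

end Normality

end ElemSympl

theorem lemma3p8 {R : Type*} [CommRing R] (hR : Ideal.span {(2 : R)} = ⊤)
    (n l : ℕ) (hn : 2 ≤ n) (hl : l + 1 = 2 * n)
    (φ : Matrix (Fin (l + 1)) (Fin (l + 1)) R)
    (hskew : φ.transpose = -φ) (hpf : ElemSympl.pfaffian (l + 1) φ = 1) :
    (IsLocalRing R →
      (ElemSympl.ESp φ).Normal ∧ ∀ I : Ideal R, (ElemSympl.relESp φ I).Normal) ∧
    (∀ (m : Ideal R) [m.IsMaximal],
      (ElemSympl.ESp (φ.map
        (Polynomial.C.comp (algebraMap R (Localization.AtPrime m))))).Normal) := by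
  have h2 : IsUnit (2 : R) := Ideal.span_singleton_eq_top.mp hR
  have hu := ElemSympl.isUnit_det_of_pfaffian_eq_one h2 hskew hpf
  have hl2 : 2 < l + 1 := by omega
  refine ⟨fun _ => ⟨ElemSympl.ESp_normal h2 hskew hu hl2,
    ElemSympl.relESp_normal h2 hskew hu hl2⟩, fun m _ => ?_⟩
  -- Invertibility of 2, skew-symmetry and invertibility of det φ all pass along f, so the Pfaffian
  -- itself need not be transported.
  set f := Polynomial.C.comp (algebraMap R (Localization.AtPrime m))
  refine ElemSympl.ESp_normal ?_ ?_ ?_ hl2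
  · have := h2.map f
    rwa [map_ofNat] at this
  · rw [← Matrix.transpose_map, hskew]
    ext i j
    simp
  · have := hu.map f
    rwa [RingHom.map_det] at this
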